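/- **Theorem 1 (Completeness).** Fix a set $\mathsf{AtProp}$ of atomic propositions. Formulas are $A ::= p \mid A/A \mid A\otimes A \mid A\backslash A \mid \Diamond A \mid \blacksquare A$ with $p\in\mathsf{AtProp}$. Antecedent structures are $X ::= A \mid X\hat\otimes X \mid \hat\Diamond X$, and succedent structures are $Y ::= A \mid Y\check/X \mid X\check\backslash Y \mid \check\blacksquare Y$. A sequent of $\mathbf{D.NL}_\Diamond$ is an expression $X\Rightarrow Y$ with $X$ an antecedent structure and $Y$ a succedent structure. The calculus $\mathbf{D.NL}_\Diamond$ has the axioms $p\Rightarrow p$; the cut rule (from $X\Rightarrow A$ and $A\Rightarrow Y$ infer $X\Rightarrow Y$); the invertible display rules $$Y\Rightarrow X\check\backslash Z \;\Longleftrightarrow\; X\hat\otimes Y\Rightarrow Z\;\Longleftrightarrow\; X\Rightarrow Z\check/Y,\qquad \hat\Diamond X\Rightarrow Y\;\Longleftrightarrow\; X\Rightarrow\check\blacksquare Y;$$ and the logical rules: - from $A\hat\otimes B\Rightarrow X$ infer $A\otimes B\Rightarrow X$; from $X\Rightarrow A$ and $Y\Rightarrow B$ infer $X\hat\otimes Y\Rightarrow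 A\otimes B$; - from $X\Rightarrow A$ and $B\Rightarrow Y$ infer $A\backslash B\Rightarrow X\check\backslash Y$; from $X\Rightarrow A\check\backslash B$ infer $X\Rightarrow A\backslash B$; - from $B\Rightarrow Y$ and $X\Rightarrow A$ infer $B/A\Rightarrow Y\check/X$; from $X\Rightarrow B\check/A$ infer $X\Rightarrow B/A$; - from $\hat\Diamond A\Rightarrow X$ infer $\Diamond A\Rightarrow X$; from $X\Rightarrow A$ infer $\hat\Diamond X\Rightarrow\Diamond A$; - from $A\Rightarrow X$ infer $\blacksquare A\Rightarrow\check\blacksquare X$; from $X\Rightarrow\check\blacksquare A$ infer $X\Rightarrow\blacksquare A$. For a field $\mathbb K$, a *modal $\mathbb K$-algebra* is a triple $(\mathbb V,\star,R)$ where $\mathbb V$ is a vector space over $\mathbb K$, $\star:\mathbb V\times\mathbb V\to\mathbb V$ is bilinear, and $R\subseteq\mathbb V\times\mathbb V$ satisfies: - if $vRu$ and $zRw$, then for all $\gamma,\delta\in\mathbb K$ there are $\alpha,\beta\in\mathbb K$ with $(\gamma v+\delta z)R(\alpha u+\beta w)$; - if $tR(\alpha u+\beta v)$, then there are $\lambda,\mu\in\mathbb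 K$ and $z,w\in\mathbb V$ with $zRu$, $wRv$ and $\lambda z+\mu w=t$; - $xR0$ if and only if $x=0$. On the subspaces of $\mathbb V$ define, with $[S]$ the linear span of $S$, $$U\otimes W=[u\star w\mid u\in U,\ w\in W],\quad Z/W=[u\mid \forall w\in W\; u\star w\in Z],\quad U\backslash Z=[w\mid\forall u\in U\; u\star w\in Z],$$ $$\Diamond U=[v\mid\exists u\in U\; vRu],\qquad \blacksquare W=[u\mid\forall v\,(vRu\Rightarrow v\in W)].$$ A valuation $\upsilon$ on $\mathbb V$ maps each atomic proposition to a subspace of $\mathbb V$. It extends homomorphically to a map $[\![-]\!]_\upsilon$ on all formulas and structures, each structural connective being interpreted as the corresponding operational one. Write $\mathbb V,\upsilon\models X\Rightarrow Y$ if $[\![X]\!]_\upsilon\subseteq[\![Y]\!]_\upsilon$. Let $X\Rightarrow Y$ be a sequent of $\mathbf{D.NL}_\Diamond$. If $\mathbb V,\upsilon\models X\Rightarrow Y$ for every field $\mathbb K$, every finite-dimensional modal $\mathbb K$-algebra $\mathbb V$ and every valuation $\upsilon$ on $\mathbb V$, then $X\Rightarrow Y$ is provable in $\mathbf{D.NL}_\Diamond$.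 -/

import Mathlib

namespace DNL

/-- Formulas over the atomic propositions `At`:
`p`, `A / B`, `A ⊗ B`, `A \ B`, `◇ A`, `■ A`. -/
inductive Fm (At : Type*) where
  | atom (p : At) : Fm At
  | slash (B A : Fm At) : Fm At
  | tensor (A B : Fm At) : Fm At
  | bslash (A B : Fm At) : Fm At
  | dia (A : Fm At) : Fm At
  | box (A : Fm At) : Fm At

/-- Structures: formulas, the hatted connectives `⊗̂`, `◇̂` (`sTensor`, `sDia`) and the checked
connectives `/̌`, `\̌`, `■̌` (`sSlash`, `sBslash`, `sBox`). -/
inductive Str (At : Type*) where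
  | fm (A : Fm At) : Str At
  | sTensor (X Y : Str At) : Str At
  | sDia (X : Str At) : Str At
  | sSlash (Z Y : Str At) : Str At
  | sBslash (X Z : Str At) : Str At
  | sBox (X : Str At) : Str At

namespace Str

/-- Antecedent structures: `X ::= A | X ⊗̂ X | ◇̂ X`. -/
def IsAnt {At : Type*} : Str At → Prop
  | fm _ => True
  | sTensor X Y => X.IsAnt ∧ Y.IsAnt
  | sDia X => X.IsAnt
  | sSlash _ _ => False
  | sBslash _ _ => False
  | sBox _ => False

/-- Succedent structures: `Y ::= A | Y /̌ X | X \̌ Y | ■̌ Y` with `X` an antecedent structure. -/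
def IsSuc {At : Type*} : Str At → Prop
  | fm _ => True
  | sTensor _ _ => False
  | sDia _ => False
  | sSlash Z Y => Z.IsSuc ∧ Y.IsAnt
  | sBslash X Z => X.IsAnt ∧ Z.IsSuc
  | sBox X => X.IsSuc

end Str

open Fm Str in
/-- `Derivable X Y`: the sequent `X ⇒ Y` is derivable in the display calculus. -/
inductive Derivable {At : Type*} : Str At → Str At → Prop
  -- identity and cut
  | id (p : At) : Derivable (fm (atom p)) (fm (atom p))
  | cut {X Y : Str At} {A : Fm At} :
      Derivable X (fm A) → Derivable (fm A) Y → Derivable X Y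
  -- display postulates, each in both directions
  | bslash_to_tensor {X Y Z : Str At} :
      Derivable Y (sBslash X Z) → Derivable (sTensor X Y) Z
  | tensor_to_bslash {X Y Z : Str At} :
      Derivable (sTensor X Y) Z → Derivable Y (sBslash X Z)
  | tensor_to_slash {X Y Z : Str At} :
      Derivable (sTensor X Y) Z → Derivable X (sSlash Z Y)
  | slash_to_tensor {X Y Z : Str At} :
      Derivable X (sSlash Z Y) → Derivable (sTensor X Y) Z
  | dia_to_box {X Y : Str At} : Derivable (sDia X) Y → Derivable X (sBox Y)
  | box_to_dia {X Y : Str At} : Derivable X (sBox Y) → Derivable (sDia X) Y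
  -- logical rules
  | tensor_left {A B : Fm At} {X : Str At} :
      Derivable (sTensor (fm A) (fm B)) X → Derivable (fm (tensor A B)) X
  | tensor_right {X Y : Str At} {A B : Fm At} :
      Derivable X (fm A) → Derivable Y (fm B) → Derivable (sTensor X Y) (fm (tensor A B))
  | bslash_left {X Y : Str At} {A B : Fm At} :
      Derivable X (fm A) → Derivable (fm B) Y → Derivable (fm (bslash A B)) (sBslash X Y)
  | bslash_right {X : Str At} {A B : Fm At} :
      Derivable X (sBslash (fm A) (fm B)) → Derivable X (fm (bslash A B))
  | slash_left {X Y : Str At} {A B : Fm At} :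
      Derivable (fm B) Y → Derivable X (fm A) → Derivable (fm (slash B A)) (sSlash Y X)
  | slash_right {X : Str At} {A B : Fm At} :
      Derivable X (sSlash (fm B) (fm A)) → Derivable X (fm (slash B A))
  | dia_left {A : Fm At} {X : Str At} :
      Derivable (sDia (fm A)) X → Derivable (fm (dia A)) X
  | dia_right {X : Str At} {A : Fm At} :
      Derivable X (fm A) → Derivable (sDia X) (fm (dia A))
  | box_left {A : Fm At} {X : Str At} :
      Derivable (fm A) X → Derivable (fm (box A)) (sBox X)
  | box_right {X : Str At} {A : Fm At} :
      Derivable X (sBox (fm A)) → Derivable X (fm (box A))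

/-- A modal algebra over the field `K` on the vector space `V`: a bilinear product and a linear,
scalar-compatible, zero-preserving relation on `V`. -/
structure ModalAlgebra (K V : Type*) [Field K] [AddCommGroup V] [Module K V] where
  /-- the bilinear product -/
  mul : V →ₗ[K] V →ₗ[K] V
  /-- the accessibility relation -/
  R : V → V → Prop
  linear_left : ∀ v u z w : V, R v u → R z w →
    ∀ γ δ : K, ∃ α β : K, R (γ • v + δ • z) (α • u + β • w)
  linear_right : ∀ (t u v : V) (α β : K), R t (α • u + β • v) →
    ∃ (l m : K) (z w : V), R z u ∧ R w v ∧ l • z + m • w = t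
  rel_zero_iff : ∀ x : V, R x 0 ↔ x = 0

namespace ModalAlgebra

variable {K V : Type*} [Field K] [AddCommGroup V] [Module K V] (M : ModalAlgebra K V)

/-- `U ⊗ W` on subspaces -/
def tensor (U W : Submodule K V) : Submodule K V :=
  Submodule.span K {z | ∃ u ∈ U, ∃ w ∈ W, z = M.mul u w}

/-- `Z / W` on subspaces -/
def slash (Z W : Submodule K V) : Submodule K V :=
  Submodule.span K {u | ∀ w ∈ W, M.mul u w ∈ Z}

/-- `U \ Z` on subspaces -/
def bslash (U Z : Submodule K V) : Submodule K V :=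
  Submodule.span K {w | ∀ u ∈ U, M.mul u w ∈ Z}

/-- `◇ U` on subspaces -/
def dia (U : Submodule K V) : Submodule K V :=
  Submodule.span K {v | ∃ u ∈ U, M.R v u}

/-- `■ W` on subspaces -/
def box (W : Submodule K V) : Submodule K V :=
  Submodule.span K {u | ∀ v, M.R v u → v ∈ W}

/-- Homomorphic extension of a valuation to formulas. -/
def evalFm {At : Type*} (val : At → Submodule K V) : Fm At → Submodule K V
  | .atom p => val p
  | .slash B A => M.slash (evalFm val B) (evalFm val A)
  | .tensor A B => M.tensor (evalFm val A) (evalFm val B)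
  | .bslash A B => M.bslash (evalFm val A) (evalFm val B)
  | .dia A => M.dia (evalFm val A)
  | .box A => M.box (evalFm val A)

/-- Homomorphic extension of a valuation to structures. -/
def evalStr {At : Type*} (val : At → Submodule K V) : Str At → Submodule K V
  | .fm A => M.evalFm val A
  | .sTensor X Y => M.tensor (evalStr val X) (evalStr val Y)
  | .sDia X => M.dia (evalStr val X)
  | .sSlash Z Y => M.slash (evalStr val Z) (evalStr val Y)
  | .sBslash X Z => M.bslash (evalStr val X) (evalStr val Z)
  | .sBox X => M.box (evalStr val X)

/-- The sequent `X ⇒ Y` holds in the modal algebra under the valuation. -/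
def Holds {At : Type*} (val : At → Submodule K V) (X Y : Str At) : Prop :=
  M.evalStr val X ≤ M.evalStr val Y

end ModalAlgebra

end DNL

/-! ### Structures read as formulas -/

namespace DNL

open Fm Str

namespace Derivable

variable {At : Type*}

/-! Completeness comes from a finite canonical Kripke frame turned into an algebra on functions over
its points. By cut, only the sequent between the formula readings of `X` and `Y` matters. Worlds are
sets of subformulas, read through their closure under entailment; with no conjunction or disjunction
in the language, no further closure or primeness is needed for the truth lemma (the `truthSet_*`
lemmas).

In the function space, sets of points become coordinate subspaces. For `/` and `\` the bilinear
product must not cancel terms, and for `⊗` the product of two basis vectors must be a single basis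
vector. A frame's ternary relation need not allow this, so `latinCover` replaces each world by
tagged copies on which any two entries of a triple fix the third. The projection lifts triples from
any one of their entries (`exists_latinCover_of_*`), so the connectives keep their frame meaning. An
infinite field makes the modal relation linear: generic combinations do not lose support. -/

theorem refl : ∀ A : Fm At, Derivable (fm A) (fm A)
  | atom p => id p
  | tensor A B => tensor_left (tensor_right (refl A) (refl B))
  | bslash A B => bslash_right (bslash_left (refl A) (refl B))
  | slash B A => slash_right (slash_left (refl B) (refl A))
  | dia A => dia_left (dia_right (refl A))
  | box A => box_right (box_left (refl A))

end Derivable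

/-- The formula obtained from a structure by reading each structural connective as the
corresponding logical one. -/
def Str.toFm {At : Type*} : Str At → Fm At
  | .fm A => A
  | .sTensor X Y => .tensor X.toFm Y.toFm
  | .sDia X => .dia X.toFm
  | .sSlash Z Y => .slash Z.toFm Y.toFm
  | .sBslash X Z => .bslash X.toFm Z.toFm
  | .sBox X => .box X.toFm

/-- The right rules for `⊗` and `◇` introduce exactly the antecedent connectives; the left rules for
the other three do the same for succedents below. -/
theorem derivable_toFm {At : Type*} : ∀ X : Str At, X.IsAnt → Derivable X (fm X.toFm)
  | .fm A, _ => .refl A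
  | .sTensor X Y, h => .tensor_right (derivable_toFm X h.1) (derivable_toFm Y h.2)
  | .sDia X, h => .dia_right (derivable_toFm X h)

theorem toFm_derivable {At : Type*} : ∀ Y : Str At, Y.IsSuc → Derivable (fm Y.toFm) Y
  | .fm A, _ => .refl A
  | .sSlash Z X, h => .slash_left (toFm_derivable Z h.1) (derivable_toFm X h.2)
  | .sBslash X Z, h => .bslash_left (derivable_toFm X h.1) (toFm_derivable Z h.2)
  | .sBox X, h => .box_left (toFm_derivable X h)

theorem ModalAlgebra.evalStr_eq_evalFm_toFm {K V : Type*} [Field K] [AddCommGroup V] [Module K V]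
    (M : ModalAlgebra K V) {At : Type*} (val : At → Submodule K V) (X : Str At) :
    M.evalStr val X = M.evalFm val X.toFm := by
  induction X <;> simp_all [ModalAlgebra.evalStr, ModalAlgebra.evalFm, Str.toFm]

/-! ### Entailment between formulas -/

/-- Derivability of the sequent `A ⇒ B` between formulas. -/
def Entails {At : Type*} (A B : Fm At) : Prop := Derivable (fm A) (fm B)

namespace Entails

variable {At : Type*} {A B C D : Fm At}

theorem refl (A : Fm At) : Entails A A := Derivable.refl A

theorem trans (h : Entails A B) (h' : Entails B C) : Entails A C := Derivable.cut h h'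

theorem tensor_mono (h : Entails A B) (h' : Entails C D) :
    Entails (.tensor A C) (.tensor B D) := .tensor_left (.tensor_right h h')

theorem dia_mono (h : Entails A B) : Entails (.dia A) (.dia B) := .dia_left (.dia_right h)

theorem slash_iff : Entails A (.slash C B) ↔ Entails (.tensor A B) C :=
  ⟨fun h => .tensor_left (.slash_to_tensor
      (.cut h (.slash_left (.refl C) (.refl B)))),
    fun h => .slash_right (.tensor_to_slash (.cut (.tensor_right (.refl A) (.refl B)) h))⟩

theorem bslash_iff : Entails B (.bslash A C) ↔ Entails (.tensor A B) C :=
  ⟨fun h => .tensor_left (.bslash_to_tensor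
      (.cut h (.bslash_left (.refl A) (.refl C)))),
    fun h => .bslash_right (.tensor_to_bslash (.cut (.tensor_right (.refl A) (.refl B)) h))⟩

theorem box_iff : Entails A (.box B) ↔ Entails (.dia A) B :=
  ⟨fun h => .dia_left (.box_to_dia (.cut h (.box_left (.refl B)))),
    fun h => .box_right (.dia_to_box (.cut (.dia_right (.refl A)) h))⟩

end Entails

/-! ### Coordinate subspaces -/

section Coord

variable {K : Type*} [Field K] {P : Type*}

/-- The subspace of functions supported on `S`. -/
def coordSub (K : Type*) [Field K] {P : Type*} (S : Set P) : Submodule K (P → K) where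
  carrier := {x | ∀ a, x a ≠ 0 → a ∈ S}
  add_mem' {x y} hx hy a h := by
    by_cases hxa : x a = 0
    · exact hy a fun hya => h (by simp [hxa, hya])
    · exact hx a hxa
  zero_mem' a h := absurd rfl h
  smul_mem' c x hx a h := hx a fun hxa => h (by simp [hxa])

theorem single_mem_coordSub [DecidableEq P] {S : Set P} {a : P} :
    (Pi.single a 1 : P → K) ∈ coordSub K S ↔ a ∈ S := by
  refine ⟨fun h => h a (by simp), fun h b hb => ?_⟩
  by_cases hab : b = a
  · exact hab ▸ h
  · simp [hab] at hb

theorem coordSub_le_iff [Fintype P] [DecidableEq P] {S : Set P} {U : Submodule K (P → K)} :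
    coordSub K S ≤ U ↔ ∀ a ∈ S, (Pi.single a 1 : P → K) ∈ U := by
  refine ⟨fun h a ha => h (single_mem_coordSub.2 ha), fun h x hx => ?_⟩
  rw [pi_eq_sum_univ' x]
  refine Submodule.sum_mem _ fun a _ => ?_
  by_cases hxa : x a = 0
  · simp [hxa]
  · refine Submodule.smul_mem _ _ ?_
    convert h a (hx a hxa) using 1

theorem coordSub_le_coordSub [DecidableEq P] {S S' : Set P} :
    coordSub K S ≤ coordSub K S' ↔ S ⊆ S' :=
  ⟨fun h _ ha => single_mem_coordSub.1 (h (single_mem_coordSub.2 ha)),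
    fun h _ hx a ha => h (hx a ha)⟩

/-- Over an infinite field some combination of two vectors has the union of their supports as its
support. -/
theorem exists_combination_support [Infinite K] [Finite P] (u w : P → K) :
    ∃ β : K, ∀ a, u a ≠ 0 ∨ w a ≠ 0 → u a + β * w a ≠ 0 := by
  -- Each point with `w a ≠ 0` rules out the single value `-u a / w a`; where `w a = 0` no choice of
  -- `β` matters.
  obtain ⟨β, hβ⟩ := ((Set.finite_range fun a => -u a / w a).union
    (Set.finite_singleton (0 : K))).exists_notMem
  simp only [Set.mem_union, Set.mem_range, Set.mem_singleton_iff, not_or, not_exists] at hβ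
  refine ⟨β, fun a ha h => ?_⟩
  by_cases hw : w a = 0
  · simp_all
  · exact hβ.1 a (by rw [div_eq_iff hw]; linear_combination -h)

end Coord

/-! ### The modal algebra of a cancellative partial operation and a relation -/

section Points

variable {P : Type*} [Fintype P]

open Classical in
/-- The bilinear extension of a ternary relation, `T a b c` meaning that `c` occurs in the product
of `a` and `b`. -/
noncomputable def relMul (K : Type*) [Field K] (T : P → P → P → Prop) :
    (P → K) →ₗ[K] (P → K) →ₗ[K] (P → K) :=
  LinearMap.mk₂ K (fun x y c => ∑ a, ∑ b, if T a b c then x a * y b else 0)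
    (fun x x' y => by
      ext c
      simp only [Pi.add_apply, ← Finset.sum_add_distrib]
      refine Finset.sum_congr rfl fun a _ => Finset.sum_congr rfl fun b _ => ?_
      split_ifs <;> ring)
    (fun r x y => by
      ext c
      simp only [Pi.smul_apply, smul_eq_mul, Finset.mul_sum]
      refine Finset.sum_congr rfl fun a _ => Finset.sum_congr rfl fun b _ => ?_
      split_ifs <;> ring)
    (fun x y y' => by
      ext c
      simp only [Pi.add_apply, ← Finset.sum_add_distrib]
      refine Finset.sum_congr rfl fun a _ => Finset.sum_congr rfl fun b _ => ?_
      split_ifs <;> ring)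
    (fun r x y => by
      ext c
      simp only [Pi.smul_apply, smul_eq_mul, Finset.mul_sum]
      refine Finset.sum_congr rfl fun a _ => Finset.sum_congr rfl fun b _ => ?_
      split_ifs <;> ring)

open Classical in
theorem relMul_apply {K : Type*} [Field K] (T : P → P → P → Prop) (x y : P → K) (c : P) :
    relMul K T x y c = ∑ a, ∑ b, if T a b c then x a * y b else 0 := rfl

variable {K : Type*} [Field K] {T : P → P → P → Prop}

theorem exists_of_relMul_ne_zero {x y : P → K} {c : P} (h : relMul K T x y c ≠ 0) :
    ∃ a b, T a b c ∧ x a ≠ 0 ∧ y b ≠ 0 := by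
  classical
  rw [relMul_apply] at h
  obtain ⟨a, -, ha⟩ := Finset.exists_ne_zero_of_sum_ne_zero h
  obtain ⟨b, -, hb⟩ := Finset.exists_ne_zero_of_sum_ne_zero ha
  split_ifs at hb with hT
  · exact ⟨a, b, hT, left_ne_zero_of_mul hb, right_ne_zero_of_mul hb⟩
  · exact absurd rfl hb

variable [DecidableEq P]

/-- Uniqueness of the left factor leaves one term in the sum, so a nonzero coordinate of `x` cannot
be cancelled. -/
theorem relMul_single_right (x : P → K) {a b c : P} (h : T a b c)
    (huniq : ∀ a', T a' b c → a' = a) : relMul K T x (Pi.single b 1) c = x a := by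
  classical
  rw [relMul_apply, Finset.sum_eq_single a, Finset.sum_eq_single b] <;>
    simp +contextual [h, Pi.single_apply]
  refine fun a' ha' => Finset.sum_eq_zero fun b' _ => ?_
  by_cases hb : b' = b
  · subst hb
    simp [mt (huniq a') ha']
  · simp [hb]

theorem relMul_single_left (y : P → K) {a b c : P} (h : T a b c)
    (huniq : ∀ b', T a b' c → b' = b) : relMul K T (Pi.single a 1) y c = y b := by
  classical
  rw [relMul_apply, Finset.sum_eq_single a, Finset.sum_eq_single b] <;>
    simp +contextual [h]
  intro b' hb' hT
  exact absurd (huniq b' hT) hb'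

theorem relMul_single_single {a b c : P} (h : T a b c) (huniq : ∀ c', T a b c' → c' = c) :
    relMul K T (Pi.single a 1) (Pi.single b 1) = Pi.single c 1 := by
  classical
  ext c'
  rw [relMul_apply, Finset.sum_eq_single a, Finset.sum_eq_single b] <;>
    simp +contextual [Pi.single_apply]
  by_cases hc : c' = c
  · simp [hc, h]
  · simp only [hc, if_false, ite_eq_right_iff]
    exact fun h' => absurd (huniq c' h') hc

/-- Every two entries of a triple in `T` determine the third. -/
structure PartialLatin (T : P → P → P → Prop) : Prop where
  fst : ∀ {a a' b c}, T a b c → T a' b c → a' = a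
  snd : ∀ {a b b' c}, T a b c → T a b' c → b' = b
  out : ∀ {a b c c'}, T a b c → T a b c' → c' = c

/-- The modal algebra on `P → K` with product induced by `T` and with `v R u` if `v` is supported
on the points that `Q` relates to a point of the support of `u`. -/
noncomputable def relAlgebra (K : Type*) [Field K] [Infinite K] (T : P → P → P → Prop)
    (Q : P → P → Prop) : ModalAlgebra K (P → K) where
  mul := relMul K T
  R v u := ∀ c, v c ≠ 0 → ∃ a, u a ≠ 0 ∧ Q c a
  linear_left v u z w hv hz γ δ := by
    -- One combination with full support works for all `γ`, `δ`.
    obtain ⟨β, hβ⟩ := exists_combination_support u w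
    refine ⟨1, β, fun c hc => ?_⟩
    simp only [Pi.add_apply, Pi.smul_apply, smul_eq_mul, one_mul] at hc ⊢
    by_cases hvc : v c = 0
    · obtain ⟨a, ha, hQ⟩ := hz c fun h => hc (by simp [hvc, h])
      exact ⟨a, hβ a (.inr ha), hQ⟩
    · obtain ⟨a, ha, hQ⟩ := hv c hvc
      exact ⟨a, hβ a (.inl ha), hQ⟩
  linear_right t u v α β h := by
    classical
    -- Split `t` by coordinates: those that `Q` relates to the support of `u`, and the rest, which
    -- must be related to the support of `v`.
    refine ⟨1, 1, fun c => if ∃ a, u a ≠ 0 ∧ Q c a then t c else 0,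
      fun c => if ∃ a, u a ≠ 0 ∧ Q c a then 0 else t c, fun c hc => ?_, fun c hc => ?_, ?_⟩
    · by_contra hn
      simp only [if_neg hn, ne_eq, not_true_eq_false] at hc
    · by_cases hn : ∃ a, u a ≠ 0 ∧ Q c a
      · simp only [if_pos hn, ne_eq, not_true_eq_false] at hc
      · simp only [if_neg hn] at hc
        obtain ⟨a, ha, hQ⟩ := h c hc
        refine ⟨a, fun hva => hn ⟨a, fun hua => ha ?_, hQ⟩, hQ⟩
        simp [hua, hva]
    · ext c
      by_cases hn : ∃ a, u a ≠ 0 ∧ Q c a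
      · simp only [Pi.add_apply, Pi.smul_apply, if_pos hn, smul_eq_mul, one_mul, add_zero]
      · simp only [Pi.add_apply, Pi.smul_apply, if_neg hn, smul_eq_mul, one_mul, zero_add]
  rel_zero_iff x := by
    refine ⟨fun h => ?_, fun h c hc => absurd (congrFun h c) hc⟩
    ext c
    by_contra hc
    obtain ⟨a, ha, -⟩ := h c hc
    exact ha rfl

variable [Infinite K] {Q : P → P → Prop}

theorem tensor_coordSub (hT : PartialLatin T) (S S' : Set P) :
    (relAlgebra K T Q).tensor (coordSub K S) (coordSub K S') =
      coordSub K {c | ∃ a ∈ S, ∃ b ∈ S', T a b c} := by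
  apply le_antisymm
  · refine Submodule.span_le.2 ?_
    rintro _ ⟨x, hx, y, hy, rfl⟩ c hc
    obtain ⟨a, b, h, ha, hb⟩ := exists_of_relMul_ne_zero hc
    exact ⟨a, hx a ha, b, hy b hb, h⟩
  · refine coordSub_le_iff.2 ?_
    rintro c ⟨a, ha, b, hb, h⟩
    exact Submodule.subset_span ⟨_, single_mem_coordSub.2 ha, _, single_mem_coordSub.2 hb,
      (relMul_single_single h fun _ => hT.out h).symm⟩

theorem slash_coordSub (hT : PartialLatin T) (Z S : Set P) :
    (relAlgebra K T Q).slash (coordSub K Z) (coordSub K S) =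
      coordSub K {a | ∀ b ∈ S, ∀ c, T a b c → c ∈ Z} := by
  apply le_antisymm
  · refine Submodule.span_le.2 fun x hx a ha b hb c h => ?_
    -- Testing against a basis vector isolates the coordinate `x a`.
    refine hx _ (single_mem_coordSub.2 hb) c ?_
    exact (relMul_single_right x h fun _ => hT.fst h).trans_ne ha
  · intro x hx
    refine Submodule.subset_span fun y hy c hc => ?_
    obtain ⟨a, b, h, ha, hb⟩ := exists_of_relMul_ne_zero hc
    exact hx a ha b (hy b hb) c h

theorem bslash_coordSub (hT : PartialLatin T) (S Z : Set P) :
    (relAlgebra K T Q).bslash (coordSub K S) (coordSub K Z) =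
      coordSub K {b | ∀ a ∈ S, ∀ c, T a b c → c ∈ Z} := by
  apply le_antisymm
  · refine Submodule.span_le.2 fun y hy b hb a ha c h => ?_
    refine hy _ (single_mem_coordSub.2 ha) c ?_
    exact (relMul_single_left y h fun _ => hT.snd h).trans_ne hb
  · intro y hy
    refine Submodule.subset_span fun x hx c hc => ?_
    obtain ⟨a, b, h, ha, hb⟩ := exists_of_relMul_ne_zero hc
    exact hy b hb a (hx a ha) c h

theorem relAlgebra_single_iff {c : P} {u : P → K} :
    (relAlgebra K T Q).R (Pi.single c 1) u ↔ ∃ a, u a ≠ 0 ∧ Q c a := by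
  refine ⟨fun h => h c (by simp), fun h c' hc' => ?_⟩
  by_cases hcc : c' = c
  · exact hcc ▸ h
  · simp [hcc] at hc'

theorem dia_coordSub (S : Set P) :
    (relAlgebra K T Q).dia (coordSub K S) = coordSub K {c | ∃ a ∈ S, Q c a} := by
  apply le_antisymm
  · refine Submodule.span_le.2 ?_
    rintro v ⟨u, hu, hv⟩ c hc
    obtain ⟨a, ha, hQ⟩ := hv c hc
    exact ⟨a, hu a ha, hQ⟩
  · refine coordSub_le_iff.2 ?_
    rintro c ⟨a, ha, hQ⟩
    exact Submodule.subset_span ⟨_, single_mem_coordSub.2 ha,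
      relAlgebra_single_iff.2 ⟨a, by simp, hQ⟩⟩

theorem box_coordSub (Z : Set P) :
    (relAlgebra K T Q).box (coordSub K Z) = coordSub K {a | ∀ c, Q c a → c ∈ Z} := by
  apply le_antisymm
  · refine Submodule.span_le.2 fun u hu a ha c hQ => ?_
    exact single_mem_coordSub.1 (hu _ (relAlgebra_single_iff.2 ⟨a, ha, hQ⟩))
  · intro u hu
    refine Submodule.subset_span fun v hv c hc => ?_
    obtain ⟨a, ha, hQ⟩ := hv c hc
    exact hu a ha c hQ

end Points

/-! ### The modal algebra of a finite frame -/

section Frame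

variable {G : Type*} [AddCommGroup G]

/-- A partial Latin square on `G × G × G` that projects onto the ternary relation `r` on `G`. -/
def latinCover (r : G → G → G → Prop) (a b c : G × G × G) : Prop :=
  r a.1 b.1 c.1 ∧ c.1 = a.2.1 + b.2.1 ∧ a.1 = b.2.2 + c.2.1 ∧ b.1 = c.2.2 + a.2.2

variable {r : G → G → G → Prop}

/-- Each world is the sum of one tag from each of the other two points, so two points give the third
world; group cancellation then gives its two tags. -/
theorem partialLatin_latinCover : PartialLatin (latinCover r) where
  fst := by
    rintro ⟨a, a₁, a₂⟩ ⟨a', a₁', a₂'⟩ ⟨b, b₁, b₂⟩ ⟨c, c₁, c₂⟩ ⟨-, h₁, h₂, h₃⟩ ⟨-, h₁', h₂', h₃'⟩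
    simp only at h₁ h₂ h₃ h₁' h₂' h₃'
    simp only [Prod.mk.injEq]
    exact ⟨h₂'.trans h₂.symm, add_right_cancel (h₁'.symm.trans h₁),
      add_left_cancel (h₃'.symm.trans h₃)⟩
  snd := by
    rintro ⟨a, a₁, a₂⟩ ⟨b, b₁, b₂⟩ ⟨b', b₁', b₂'⟩ ⟨c, c₁, c₂⟩ ⟨-, h₁, h₂, h₃⟩ ⟨-, h₁', h₂', h₃'⟩
    simp only at h₁ h₂ h₃ h₁' h₂' h₃'
    simp only [Prod.mk.injEq]
    exact ⟨h₃'.trans h₃.symm, add_left_cancel (h₁'.symm.trans h₁),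
      add_right_cancel (h₂'.symm.trans h₂)⟩
  out := by
    rintro ⟨a, a₁, a₂⟩ ⟨b, b₁, b₂⟩ ⟨c, c₁, c₂⟩ ⟨c', c₁', c₂'⟩ ⟨-, h₁, h₂, h₃⟩ ⟨-, h₁', h₂', h₃'⟩
    simp only at h₁ h₂ h₃ h₁' h₂' h₃'
    simp only [Prod.mk.injEq]
    exact ⟨h₁'.trans h₁.symm, add_left_cancel (h₂'.symm.trans h₂),
      add_right_cancel (h₃'.symm.trans h₃)⟩

/-- With one point fixed, the three equations involve four free tags; one is set to `0` and the
others are solved for. -/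
theorem exists_latinCover_of_out {u v : G} {c : G × G × G} (h : r u v c.1) :
    ∃ a b, a.1 = u ∧ b.1 = v ∧ latinCover r a b c :=
  ⟨(u, 0, v - c.2.2), (v, c.1, u - c.2.1), rfl, rfl, h, by simp, by simp, by simp⟩

theorem exists_latinCover_of_fst {a : G × G × G} {v w : G} (h : r a.1 v w) :
    ∃ b c, b.1 = v ∧ c.1 = w ∧ latinCover r a b c :=
  ⟨(v, w - a.2.1, 0), (w, a.1, v - a.2.2), rfl, rfl, h, by simp, by simp, by simp⟩

theorem exists_latinCover_of_snd {u w : G} {b : G × G × G} (h : r u b.1 w) :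
    ∃ a c, a.1 = u ∧ c.1 = w ∧ latinCover r a b c :=
  ⟨(u, w - b.2.1, 0), (w, u - b.2.2, b.1), rfl, rfl, h, by simp, by simp, by simp⟩

/-- The subspace spanned by the points over a set of worlds. -/
def cover (K : Type*) [Field K] {G : Type*} (S : Set G) : Submodule K (G × G × G → K) :=
  coordSub K (Prod.fst ⁻¹' S)

theorem cover_le_cover {K : Type*} [Field K] {G : Type*} [DecidableEq G] {S S' : Set G} : cover K S ≤ cover K S' ↔ S ⊆ S' :=
  coordSub_le_coordSub.trans
    ⟨fun h u hu => h (show (u, u, u) ∈ Prod.fst ⁻¹' S from hu), fun h _ ha => h ha⟩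

variable [Fintype G] [DecidableEq G] {K : Type*} [Field K] [Infinite K] {q : G → G → Prop}

/-- The modal algebra of a finite frame whose worlds form an abelian group. -/
noncomputable def frameAlgebra (K : Type*) [Field K] [Infinite K] (r : G → G → G → Prop)
    (q : G → G → Prop) : ModalAlgebra K (G × G × G → K) :=
  relAlgebra K (latinCover r) fun c a => q c.1 a.1

theorem tensor_cover (S S' : Set G) :
    (frameAlgebra K r q).tensor (cover K S) (cover K S') =
      cover K {w | ∃ u ∈ S, ∃ v ∈ S', r u v w} := by
  refine (tensor_coordSub partialLatin_latinCover _ _).trans (congrArg (coordSub K) ?_)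
  ext c
  constructor
  · rintro ⟨a, ha, b, hb, h⟩
    exact ⟨a.1, ha, b.1, hb, h.1⟩
  · rintro ⟨u, hu, v, hv, h⟩
    obtain ⟨a, b, rfl, rfl, h'⟩ := exists_latinCover_of_out h
    exact ⟨a, hu, b, hv, h'⟩

theorem slash_cover (Z S : Set G) :
    (frameAlgebra K r q).slash (cover K Z) (cover K S) =
      cover K {u | ∀ v ∈ S, ∀ w, r u v w → w ∈ Z} := by
  refine (slash_coordSub partialLatin_latinCover _ _).trans (congrArg (coordSub K) ?_)
  ext a
  constructor
  · intro ha v hv w h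
    obtain ⟨b, c, rfl, rfl, h'⟩ := exists_latinCover_of_fst h
    exact ha b hv c h'
  · exact fun ha b hb c h => ha b.1 hb c.1 h.1

theorem bslash_cover (S Z : Set G) :
    (frameAlgebra K r q).bslash (cover K S) (cover K Z) =
      cover K {v | ∀ u ∈ S, ∀ w, r u v w → w ∈ Z} := by
  refine (bslash_coordSub partialLatin_latinCover _ _).trans (congrArg (coordSub K) ?_)
  ext b
  constructor
  · intro hb u hu w h
    obtain ⟨a, c, rfl, rfl, h'⟩ := exists_latinCover_of_snd h
    exact hb a hu c h'
  · exact fun hb a ha c h => hb a.1 ha c.1 h.1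

theorem dia_cover (S : Set G) :
    (frameAlgebra K r q).dia (cover K S) = cover K {w | ∃ u ∈ S, q w u} := by
  refine (dia_coordSub _).trans (congrArg (coordSub K) ?_)
  ext c
  constructor
  · rintro ⟨a, ha, h⟩
    exact ⟨a.1, ha, h⟩
  · rintro ⟨u, hu, h⟩
    exact ⟨(u, u, u), hu, h⟩

theorem box_cover (Z : Set G) :
    (frameAlgebra K r q).box (cover K Z) = cover K {u | ∀ w, q w u → w ∈ Z} := by
  refine (box_coordSub _).trans (congrArg (coordSub K) ?_)
  ext a
  constructor
  · exact fun ha w h => ha (w, w, w) h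
  · exact fun ha c h => ha c.1 h

end Frame

/-! ### The canonical frame of a finite subformula-closed list -/

section Canonical

variable {At : Type*}

/-- `L` contains the immediate subformulas of its members. -/
structure SubformulaClosed (L : List (Fm At)) : Prop where
  tensor : ∀ {A B}, Fm.tensor A B ∈ L → A ∈ L ∧ B ∈ L
  slash : ∀ {B A}, Fm.slash B A ∈ L → B ∈ L ∧ A ∈ L
  bslash : ∀ {A B}, Fm.bslash A B ∈ L → A ∈ L ∧ B ∈ L
  dia : ∀ {A}, Fm.dia A ∈ L → A ∈ L
  box : ∀ {A}, Fm.box A ∈ L → A ∈ L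

/-- The subformulas of a formula. -/
def subformulas : Fm At → List (Fm At)
  | .atom p => [.atom p]
  | .slash B A => .slash B A :: (subformulas B ++ subformulas A)
  | .tensor A B => .tensor A B :: (subformulas A ++ subformulas B)
  | .bslash A B => .bslash A B :: (subformulas A ++ subformulas B)
  | .dia A => .dia A :: subformulas A
  | .box A => .box A :: subformulas A

theorem mem_subformulas_self (A : Fm At) : A ∈ subformulas A := by
  cases A <;> simp [subformulas]

theorem subformulaClosed_subformulas (A : Fm At) : SubformulaClosed (subformulas A) := by
  induction A with
  | atom p => constructor <;> simp [subformulas]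
  | slash A B ihA ihB | tensor A B ihA ihB | bslash A B ihA ihB =>
    have hA := mem_subformulas_self A
    have hB := mem_subformulas_self B
    obtain ⟨a₁, a₂, a₃, a₄, a₅⟩ := ihA
    obtain ⟨b₁, b₂, b₃, b₄, b₅⟩ := ihB
    constructor <;> simp only [subformulas, List.mem_cons, List.mem_append] <;> grind
  | dia A ihA | box A ihA =>
    have hA := mem_subformulas_self A
    obtain ⟨a₁, a₂, a₃, a₄, a₅⟩ := ihA
    constructor <;> simp only [subformulas, List.mem_cons] <;> grind

theorem SubformulaClosed.append {L L' : List (Fm At)} (h : SubformulaClosed L)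
    (h' : SubformulaClosed L') : SubformulaClosed (L ++ L') := by
  obtain ⟨a₁, a₂, a₃, a₄, a₅⟩ := h
  obtain ⟨b₁, b₂, b₃, b₄, b₅⟩ := h'
  constructor <;> simp only [List.mem_append] <;> grind

/-- Worlds over `L` are (indicator functions of) sets of members of `L`. -/
abbrev World (L : List (Fm At)) : Type := Fin L.length → ZMod 2

variable {L : List (Fm At)}

/-- The formulas entailed by some member of a world. -/
def World.theory (w : World L) : Set (Fm At) := {C | ∃ i, w i ≠ 0 ∧ Entails (L.get i) C}

theorem World.mem_theory_of_entails {w : World L} {C D : Fm At} (h : C ∈ w.theory)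
    (hCD : Entails C D) : D ∈ w.theory :=
  h.imp fun _ hi => ⟨hi.1, hi.2.trans hCD⟩

/-- The world is the trace of `S` on `L`; closure of `S` under entailment keeps its theory inside
`S`. -/
theorem exists_world (L : List (Fm At)) (S : Set (Fm At))
    (hS : ∀ C D, C ∈ S → Entails C D → D ∈ S) :
    ∃ w : World L, w.theory ⊆ S ∧ ∀ C ∈ L, C ∈ S → C ∈ w.theory := by
  classical
  refine ⟨fun i => if L.get i ∈ S then 1 else 0, ?_, fun C hC hCS => ?_⟩
  · rintro C ⟨i, hi, hC⟩
    by_cases h : L.get i ∈ S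
    · exact hS _ _ h hC
    · simp only [if_neg h, ne_eq, not_true_eq_false] at hi
  · obtain ⟨i, rfl⟩ := List.mem_iff_get.1 hC
    exact ⟨i, by simp only [if_pos hCS, ne_eq, one_ne_zero, not_false_eq_true], .refl _⟩

theorem exists_world_of_formula (L : List (Fm At)) (A : Fm At) :
    ∃ w : World L, (∀ C ∈ w.theory, Entails A C) ∧ (A ∈ L → A ∈ w.theory) := by
  obtain ⟨w, h, h'⟩ := exists_world L {C | Entails A C} fun _ _ => Entails.trans
  exact ⟨w, fun C hC => h hC, fun hA => h' A hA (.refl A)⟩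

/-- The canonical ternary relation. -/
def canonicalMul (u v w : World L) : Prop :=
  ∀ D ∈ u.theory, ∀ E ∈ v.theory, ∀ C ∈ L, Entails (.tensor D E) C → C ∈ w.theory

/-- The canonical binary relation. -/
def canonicalRel (w u : World L) : Prop :=
  ∀ D ∈ u.theory, ∀ C ∈ L, Entails (.dia D) C → C ∈ w.theory

/-- A product world with nothing superfluous: membership in it yields an actual derivation, as the
residuals require. -/
theorem exists_canonicalMul (u v : World L) : ∃ w, canonicalMul u v w ∧
    ∀ C ∈ w.theory, ∃ D ∈ u.theory, ∃ E ∈ v.theory, Entails (.tensor D E) C := by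
  obtain ⟨w, h, h'⟩ := exists_world L
    {C | ∃ D ∈ u.theory, ∃ E ∈ v.theory, Entails (.tensor D E) C}
    fun C C' ⟨D, hD, E, hE, hC⟩ h => ⟨D, hD, E, hE, hC.trans h⟩
  exact ⟨w, fun D hD E hE C hC hDE => h' C hC ⟨D, hD, E, hE, hDE⟩, fun C hC => h hC⟩

theorem exists_canonicalRel (u : World L) : ∃ w, canonicalRel w u ∧
    ∀ C ∈ w.theory, ∃ D ∈ u.theory, Entails (.dia D) C := by
  obtain ⟨w, h, h'⟩ := exists_world L {C | ∃ D ∈ u.theory, Entails (.dia D) C}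
    fun C C' ⟨D, hD, hC⟩ h => ⟨D, hD, hC.trans h⟩
  exact ⟨w, fun D hD C hC hDC => h' C hC ⟨D, hD, hDC⟩, fun C hC => h hC⟩

/-- The worlds whose theory contains a formula. -/
def truthSet (L : List (Fm At)) (C : Fm At) : Set (World L) := {w | C ∈ w.theory}

theorem truthSet_tensor (hL : SubformulaClosed L) {A B : Fm At} (h : Fm.tensor A B ∈ L) :
    {w | ∃ u ∈ truthSet L A, ∃ v ∈ truthSet L B, canonicalMul u v w} =
      truthSet L (.tensor A B) := by
  ext w
  constructor
  · rintro ⟨u, hu, v, hv, hw⟩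
    exact hw A hu B hv _ h (.refl _)
  · intro hw
    obtain ⟨u, hu, hu'⟩ := exists_world_of_formula L A
    obtain ⟨v, hv, hv'⟩ := exists_world_of_formula L B
    -- `u` and `v` hold only consequences of `A` and `B`, so by monotonicity whatever their product
    -- forces already follows from `A ⊗ B`.
    exact ⟨u, hu' (hL.tensor h).1, v, hv' (hL.tensor h).2, fun D hD E hE C _ hC =>
      World.mem_theory_of_entails hw ((Entails.tensor_mono (hu D hD) (hv E hE)).trans hC)⟩

theorem truthSet_slash (hL : SubformulaClosed L) {B A : Fm At} (h : Fm.slash B A ∈ L) :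
    {u | ∀ v ∈ truthSet L A, ∀ w, canonicalMul u v w → w ∈ truthSet L B} =
      truthSet L (.slash B A) := by
  ext u
  constructor
  · intro hu
    obtain ⟨v, hv, hv'⟩ := exists_world_of_formula L A
    -- In this tight product, `B` is entailed by `D ⊗ E` with `A` entailing `E`; residuation then
    -- puts `B / A` in the theory of `u`.
    obtain ⟨w, hw, hw'⟩ := exists_canonicalMul u v
    obtain ⟨D, hD, E, hE, hB⟩ := hw' B (hu v (hv' (hL.slash h).2) w hw)
    exact World.mem_theory_of_entails hD
      (Entails.slash_iff.2 ((Entails.tensor_mono (.refl D) (hv E hE)).trans hB))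
  · intro hu v hv w hw
    exact hw _ hu A hv B (hL.slash h).1 (Entails.slash_iff.1 (.refl _))

theorem truthSet_bslash (hL : SubformulaClosed L) {A B : Fm At} (h : Fm.bslash A B ∈ L) :
    {v | ∀ u ∈ truthSet L A, ∀ w, canonicalMul u v w → w ∈ truthSet L B} =
      truthSet L (.bslash A B) := by
  ext v
  constructor
  · intro hv
    obtain ⟨u, hu, hu'⟩ := exists_world_of_formula L A
    obtain ⟨w, hw, hw'⟩ := exists_canonicalMul u v
    obtain ⟨D, hD, E, hE, hB⟩ := hw' B (hv u (hu' (hL.bslash h).1) w hw)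
    exact World.mem_theory_of_entails hE
      (Entails.bslash_iff.2 ((Entails.tensor_mono (hu D hD) (.refl E)).trans hB))
  · intro hv u hu w hw
    exact hw A hu _ hv B (hL.bslash h).2 (Entails.bslash_iff.1 (.refl _))

theorem truthSet_dia (hL : SubformulaClosed L) {A : Fm At} (h : Fm.dia A ∈ L) :
    {w | ∃ u ∈ truthSet L A, canonicalRel w u} = truthSet L (.dia A) := by
  ext w
  constructor
  · rintro ⟨u, hu, hw⟩
    exact hw A hu _ h (.refl _)
  · intro hw
    obtain ⟨u, hu, hu'⟩ := exists_world_of_formula L A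
    exact ⟨u, hu' (hL.dia h), fun D hD C _ hC =>
      World.mem_theory_of_entails hw ((Entails.dia_mono (hu D hD)).trans hC)⟩

theorem truthSet_box (hL : SubformulaClosed L) {A : Fm At} (h : Fm.box A ∈ L) :
    {u | ∀ w, canonicalRel w u → w ∈ truthSet L A} = truthSet L (.box A) := by
  ext u
  constructor
  · intro hu
    obtain ⟨w, hw, hw'⟩ := exists_canonicalRel u
    obtain ⟨D, hD, hA⟩ := hw' A (hu w hw)
    exact World.mem_theory_of_entails hD (Entails.box_iff.2 hA)
  · intro hu w hw
    exact hw _ hu A (hL.box h) (Entails.box_iff.1 (.refl _))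

/-- The canonical modal algebra of a list of formulas. -/
noncomputable def canonicalAlgebra (K : Type*) [Field K] [Infinite K] (L : List (Fm At)) :
    ModalAlgebra K (World L × World L × World L → K) :=
  frameAlgebra K canonicalMul canonicalRel

/-- The truth lemma, carried from the frame to subspaces. -/
theorem evalFm_canonicalAlgebra {K : Type*} [Field K] [Infinite K] (hL : SubformulaClosed L) :
    ∀ C ∈ L, (canonicalAlgebra K L).evalFm (fun p => cover K (truthSet L (.atom p))) C =
      cover K (truthSet L C)
  | .atom _, _ => rfl
  | .tensor A B, h => by
    rw [ModalAlgebra.evalFm, evalFm_canonicalAlgebra hL A (hL.tensor h).1,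
      evalFm_canonicalAlgebra hL B (hL.tensor h).2, ← truthSet_tensor hL h]
    exact tensor_cover _ _
  | .slash B A, h => by
    rw [ModalAlgebra.evalFm, evalFm_canonicalAlgebra hL A (hL.slash h).2,
      evalFm_canonicalAlgebra hL B (hL.slash h).1, ← truthSet_slash hL h]
    exact slash_cover _ _
  | .bslash A B, h => by
    rw [ModalAlgebra.evalFm, evalFm_canonicalAlgebra hL A (hL.bslash h).1,
      evalFm_canonicalAlgebra hL B (hL.bslash h).2, ← truthSet_bslash hL h]
    exact bslash_cover _ _
  | .dia A, h => by
    rw [ModalAlgebra.evalFm, evalFm_canonicalAlgebra hL A (hL.dia h), ← truthSet_dia hL h]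
    exact dia_cover _
  | .box A, h => by
    rw [ModalAlgebra.evalFm, evalFm_canonicalAlgebra hL A (hL.box h), ← truthSet_box hL h]
    exact box_cover _

end Canonical

end DNL

/-! ### Completeness -/

theorem theorem1 {At : Type*} (X Y : DNL.Str At) (hX : X.IsAnt) (hY : Y.IsSuc)
    (hvalid : ∀ (K : Type) [Field K] (V : Type) [AddCommGroup V] [Module K V]
      [FiniteDimensional K V] (M : DNL.ModalAlgebra K V) (val : At → Submodule K V),
      M.Holds val X Y) :
    DNL.Derivable X Y := by
  have hL := (DNL.subformulaClosed_subformulas X.toFm).append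
    (DNL.subformulaClosed_subformulas Y.toFm)
  set L := DNL.subformulas X.toFm ++ DNL.subformulas Y.toFm
  have hXL : X.toFm ∈ L := List.mem_append_left _ (DNL.mem_subformulas_self _)
  have hYL : Y.toFm ∈ L := List.mem_append_right _ (DNL.mem_subformulas_self _)
  -- `ℚ` serves as an infinite field. Worlds use indices into `L`, so the space lies in `Type`
  -- whatever the universe of `At`.
  have h := hvalid ℚ _ (DNL.canonicalAlgebra ℚ L)
    fun p => DNL.cover ℚ (DNL.truthSet L (.atom p))
  rw [DNL.ModalAlgebra.Holds, DNL.ModalAlgebra.evalStr_eq_evalFm_toFm,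
    DNL.ModalAlgebra.evalStr_eq_evalFm_toFm, DNL.evalFm_canonicalAlgebra hL _ hXL,
    DNL.evalFm_canonicalAlgebra hL _ hYL, DNL.cover_le_cover] at h
  -- This world satisfies `X.toFm`, hence `Y.toFm`, and its theory contains only consequences of
  -- `X.toFm`.
  obtain ⟨w, hw, hw'⟩ := DNL.exists_world_of_formula L X.toFm
  exact .cut (DNL.derivable_toFm X hX)
    (.cut (hw _ (h (hw' hXL))) (DNL.toFm_derivable Y hY))
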